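/- **Theorem (Upper bound).** Let $K$ be a field of characteristic $0$ (for instance $K=\mathbb{C}$), let $R=K[x,y,z]$, and let $I\subset R$ be a monomial ideal such that $R/I$ is Artinian and $\dim_K R/I=l=\binom{k+2}{3}+\Delta$, where $k\ge 1$ and $0\le\Delta\le\binom{k+2}{2}-1$ are integers. Assume that $I$ is Borel-fixed, i.e. for every minimal monomial generator $g$ of $I$: if $z\mid g$ then $\frac{xg}{z},\frac{yg}{z}\in I$, and if $y\mid g$ then $\frac{xg}{y}\in I$. Let $m_1,m_2,m_3$ be the pure exponents of $I$, i.e. $x^{m_1},y^{m_2},z^{m_3}$ are minimal monomial generators of $I$. Let $T(I)=\dim_K\operatorname{Hom}_R(I,R/I)$ be the dimension of the tangent space at $[I]$ to the Hilbert scheme of $l$ points of $\mathbb{A}^3$. Then $\operatorname{Hom}_R(I,R/I)$ is finite-dimensional over $K$ and $$T(I)\le(2m_1+1)\,l-2\binom{m_1+2}{4}.$$ -/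

import Mathlib

open MvPolynomial

/-- The ideal `I` of `K[x, y, z] = MvPolynomial (Fin 3) K` (with `x = X 0`, `y = X 1`, `z = X 2`)
is a monomial ideal: it is generated by a set of monomials. -/
def IsMonomialIdeal {K : Type*} [Field K] (I : Ideal (MvPolynomial (Fin 3) K)) : Prop :=
  ∃ S : Set (Fin 3 →₀ ℕ), I = Ideal.span ((fun a => monomial a (1 : K)) '' S)

/-- `a` is the exponent vector of a minimal monomial generator of `I`: the monomial with exponent
vector `a` lies in `I`, and no monomial properly dividing it does. -/
def IsMinimalGenerator {K : Type*} [Field K] (I : Ideal (MvPolynomial (Fin 3) K))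
    (a : Fin 3 →₀ ℕ) : Prop :=
  Minimal (fun b : Fin 3 →₀ ℕ => monomial b (1 : K) ∈ I) a

/-- `I` is Borel-fixed: it is a monomial ideal, and for every minimal monomial generator `g` of `I`
and all variables `X i`, `X j` with `i < j` and `X j ∣ g`, the monomial `X i * g / X j` is in `I`.
The pairs `i < j` are `(x, z)`, `(y, z)` and `(x, y)`. -/
def IsBorelFixed {K : Type*} [Field K] (I : Ideal (MvPolynomial (Fin 3) K)) : Prop :=
  IsMonomialIdeal I ∧
    ∀ a : Fin 3 →₀ ℕ, IsMinimalGenerator I a →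
      ∀ i j : Fin 3, i < j → 0 < a j →
        monomial (a - Finsupp.single j 1 + Finsupp.single i 1) (1 : K) ∈ I

/-- `m` is the pure exponent of `I` in the variable `X i`: the pure power `X i ^ m` is a minimal
monomial generator of `I`. -/
def IsPureExponent {K : Type*} [Field K] (I : Ideal (MvPolynomial (Fin 3) K))
    (i : Fin 3) (m : ℕ) : Prop :=
  IsMinimalGenerator I (Finsupp.single i m)

/-- The tangent space at the point `[I]` of the Hilbert scheme of points of affine 3-space:
the `K`-vector space of `K[x, y, z]`-linear maps from `I` to `K[x, y, z] / I`. -/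
abbrev TangentSpaceAt {K : Type*} [Field K] (I : Ideal (MvPolynomial (Fin 3) K)) : Type _ :=
  I →ₗ[MvPolynomial (Fin 3) K] (MvPolynomial (Fin 3) K ⧸ I)

/-! Put S = K[y,z] and slice by powers of x: I is the sum of the x^i J_i for an increasing chain of
planar monomial ideals with J_{m₁} = S, so R/I is the sum of the x^j S/J_j over j < m₁, and l = ∑
dim S/J_j. A tangent vector vanishing on the slices below i restricts on slice i to S-linear maps
J_i → S/J_j that kill J_{i-1}. Filtering by the first slice with nonzero values gives T(I) ≤ ∑_{i ≤
m₁} ∑_{j < m₁} dim Hom_S(J_i/J_{i-1}, S/J_j) (`finrank_tangentSpace_le`).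

Each summand is a planar problem. The column resolution of J has one more generator than relations,
so dim Hom(J, S/J') is dim S/J' plus the dimension of a cokernel, which is at most dim (J : J')/J
(`finrank_monomialHoms_shift_le`). Requiring the maps to kill J'' replaces dim S/J' by dim (J' :
J'')/J' (`finrank_vanishing_add_le`).

Borel-fixedness enters through the colon ideals: trading y and z for x shows that, for i ≤ j < m₁,
J_i : J_j has no monomial of degree below j - i, while all C(j-i+1, 2) such monomials survive in
S/J_i (`card_colonFinset_add_le`). So the (i,j) summand is at most dim S/J_i + dim S/J_j - c_ij,
with c_ij = C(j-i+1, 2) if i ≤ j and C(i-j, 2) otherwise. The dimensions add up to (2m₁+1) l and the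
c_ij to 2 C(m₁+2, 4). -/

/-! ### Homomorphisms from a planar monomial ideal to a cyclic module; (b, c) stands for y^b z^c. -/

section PlanarHom

variable {K V : Type*} [Field K] [AddCommGroup V] [Module K V]

/-- For an action `act` of the monoid `ℕ × ℕ` of monomials in two variables on `V` and the set `A`
of exponents of a monomial ideal `J` in two variables, the space of linear maps `J → V` compatible
with the action, recorded by their values on the monomials of `J`. -/
def monomialHoms (act : ℕ × ℕ → Module.End K V) (A : Set (ℕ × ℕ)) :
    Submodule K (ℕ × ℕ → V) where
  carrier := {f | (∀ u, u ∉ A → f u = 0) ∧ ∀ u ∈ A, ∀ w, f (w + u) = act w (f u)}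
  add_mem' := by
    rintro f g ⟨hf, hf'⟩ ⟨hg, hg'⟩
    refine ⟨fun u hu => by simp [hf u hu, hg u hu], fun u hu w => ?_⟩
    simp [hf' u hu w, hg' u hu w]
  zero_mem' := by simp
  smul_mem' := by
    rintro c f ⟨hf, hf'⟩
    refine ⟨fun u hu => by simp [hf u hu], fun u hu w => ?_⟩
    simp [hf' u hu w]

/-- The cokernel of the dualized planar resolution of a monomial ideal with column heights `h`
vanishes as soon as the classes dual to the monomials in `Q` do. -/
theorem columns_eq_zero {D : Type*} [AddCommGroup D] [Module K D]
    (act : ℕ × ℕ → Module.End K V) (hact : ∀ u w v, act (u + w) v = act u (act w v))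
    (v₀ : V) (hspan : Submodule.span K (Set.range fun u => act u v₀) = ⊤)
    (h : ℕ → ℕ) (hanti : Antitone h) (n : ℕ) (g : ℕ → V →ₗ[K] D)
    (hg0 : ∀ v, g 0 (act (1, 0) v) = 0)
    (hgs : ∀ k v, g (k + 1) (act (1, 0) v) = g k (act (0, h k - h (k + 1)) v))
    (hgn : ∀ k, n ≤ k → g k = 0) (Q : Set (ℕ × ℕ))
    (hQ : ∀ b c, c < h b → (∀ p q, act (p, q) v₀ = 0 → h (b + p) ≤ c + q) → (b, c) ∈ Q)
    (hgQ : ∀ b c, (b, c) ∈ Q → g b (act (0, h b - 1 - c) v₀) = 0) (k : ℕ) : g k = 0 := by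
  have hcomm : ∀ u w v, act u (act w v) = act w (act u v) := fun u w v => by
    rw [← hact, add_comm, hact]
  -- A factor z^(h k) is enough to push the class rightwards, slot by slot, until it reaches slot n,
  -- where everything is zero.
  have htop : ∀ d k v, n ≤ k + d → g k (act (0, h k) v) = 0 := by
    intro d
    induction d with
    | zero => intro k v hk; rw [hgn k (by omega)]; rfl
    | succ d ih =>
      intro k v hk
      have e : ((0, h k) : ℕ × ℕ) = (0, h k - h (k + 1)) + (0, h (k + 1)) := by
        have := hanti (Nat.le_succ k)
        ext <;> simp at this ⊢; omega
      rw [e, hact, ← hgs, hcomm]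
      exact ih (k + 1) _ (by omega)
  have hshift : ∀ p k v, g (k + p) (act (p, 0) v) = g k (act (0, h k - h (k + p)) v) := by
    intro p
    induction p with
    | zero => intro k v; simp
    | succ p ih =>
      intro k v
      have e : ((p + 1, 0) : ℕ × ℕ) = (1, 0) + (p, 0) := by ext <;> simp; omega
      have e2 : ((0, h k - h (k + (p + 1))) : ℕ × ℕ)
          = (0, h k - h (k + p)) + (0, h (k + p) - h (k + p + 1)) := by
        have h1 := hanti (Nat.le_succ (k + p))
        have h2 := hanti (Nat.le_add_right k p)
        simp only [Nat.succ_eq_add_one] at h1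
        ext <;> simp [← add_assoc]; omega
      rw [e, hact, ← add_assoc, hgs, hcomm, ih, ← hact, ← e2, add_assoc]
  -- Pushing left k times reaches slot 0 with a factor y to spare, which `hg0` kills.
  have hz : ∀ p k v, k < p → g k (act (p, 0) v) = 0 := by
    intro p k v hkp
    have e : ((p, 0) : ℕ × ℕ) = (k, 0) + ((1, 0) + (p - k - 1, 0)) := by ext <;> simp; omega
    have := hshift k 0 (act ((1, 0) + (p - k - 1, 0)) v)
    rw [zero_add] at this
    rw [e, hact, this, ← hact, add_comm, add_assoc, hact, hg0]
  have hcol : ∀ k t, g k (act (0, t) v₀) = 0 := by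
    intro k t
    by_cases ht : h k ≤ t
    · have e : ((0, t) : ℕ × ℕ) = (0, h k) + (0, t - h k) := by ext <;> simp; omega
      rw [e, hact]
      exact htop n k _ (by omega)
    · by_cases hq : ∀ p q, act (p, q) v₀ = 0 → h (k + p) ≤ (h k - 1 - t) + q
      · have := hgQ k _ (hQ k (h k - 1 - t) (by omega) hq)
        rwa [show h k - 1 - (h k - 1 - t) = t by omega] at this
      -- Here some y^p z^q kills `v₀` although its product with y^k z^(h k - 1 - t) stays outside J.
      -- Pushing right by p slots then leaves a multiple of y^p z^q acting on `v₀`.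
      · push Not at hq
        obtain ⟨p, q, hpq, hlt⟩ := hq
        have hle := hanti (Nat.le_add_right k p)
        have e : ((0, t) : ℕ × ℕ) = (0, h k - h (k + p)) + (0, t - (h k - h (k + p))) := by
          ext <;> simp; omega
        have e2 : ((p, 0) : ℕ × ℕ) + (0, t - (h k - h (k + p)))
            = (0, t - (h k - h (k + p)) - q) + (p, q) := by
          ext <;> simp; omega
        rw [e, hact, ← hshift, ← hact, e2, hact, hpq, map_zero, map_zero]
  ext v
  have hv : v ∈ Submodule.span K (Set.range fun u => act u v₀) := hspan ▸ Submodule.mem_top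
  induction hv using Submodule.span_induction with
  | mem x hx =>
    obtain ⟨⟨p, q⟩, rfl⟩ := hx
    have e : ((p, q) : ℕ × ℕ) = (p, 0) + (0, q) := by ext <;> simp
    simp only [LinearMap.zero_apply]
    rw [e, hact]
    by_cases hp : k < p
    · exact hz p k _ hp
    · have := hshift p (k - p) (act (0, q) v₀)
      rw [Nat.sub_add_cancel (by omega)] at this
      rw [this, ← hact]
      simpa using hcol (k - p) _
  | zero => simp
  | add x y _ _ hx hy => simp [hx, hy]
  | smul c x _ hx => simp [hx]

/-- The dualized planar resolution of the monomial ideal with column heights `h`. -/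
def columnMap (act : ℕ × ℕ → Module.End K V) (h : ℕ → ℕ) (n : ℕ) :
    (Fin (n + 1) → V) →ₗ[K] (Fin n → V) :=
  LinearMap.pi fun i => act (0, h i - h (i + 1)) ∘ₗ LinearMap.proj i.succ
    - act (1, 0) ∘ₗ LinearMap.proj i.castSucc

/-- By `columns_eq_zero`, at most `Q.card` vectors generate the cokernel. Hence the rank is at least
n dim V - #Q, and rank–nullity on a source of dimension (n+1) dim V gives the bound. -/
theorem finrank_ker_columnMap_le [FiniteDimensional K V]
    (act : ℕ × ℕ → Module.End K V) (hact : ∀ u w v, act (u + w) v = act u (act w v))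
    (v₀ : V) (hspan : Submodule.span K (Set.range fun u => act u v₀) = ⊤)
    (h : ℕ → ℕ) (hanti : Antitone h) (n : ℕ) (Q : Finset (ℕ × ℕ))
    (hQ : ∀ b c, c < h b → (∀ p q, act (p, q) v₀ = 0 → h (b + p) ≤ c + q) → (b, c) ∈ Q) :
    Module.finrank K (LinearMap.ker (columnMap act h n)) ≤ Module.finrank K V + Q.card := by
  classical
  set M := columnMap act h n with hM
  -- The exponent `h b - 1 - c` is complementary to c in a column of height `h b`: this is the
  -- duality between the cokernel and (J : Ann v₀)/J.
  let t : ℕ × ℕ → Fin n → V := fun s i =>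
    if (i : ℕ) = s.1 then act (0, h s.1 - 1 - s.2) v₀ else 0
  have htop : LinearMap.range M ⊔ Submodule.span K (Q.image t : Set (Fin n → V)) = ⊤ := by
    set U := LinearMap.range M ⊔ Submodule.span K (Q.image t : Set (Fin n → V)) with hU
    let g : ℕ → V →ₗ[K] ((Fin n → V) ⧸ U) := fun k =>
      if hk : k < n then U.mkQ ∘ₗ LinearMap.single K (fun _ => V) ⟨k, hk⟩ else 0
    have hrange : ∀ w, U.mkQ (M w) = 0 := fun w => by
      rw [Submodule.mkQ_apply, Submodule.Quotient.mk_eq_zero]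
      exact Submodule.mem_sup_left ⟨w, rfl⟩
    have hg : ∀ k, g k = 0 := by
      refine columns_eq_zero act hact v₀ hspan h hanti n g ?_ ?_ ?_ (Q : Set (ℕ × ℕ)) ?_ ?_
      · intro v
        by_cases hk : 0 < n
        · have : Pi.single (⟨0, hk⟩ : Fin n) (act (1, 0) v)
              = - M (Pi.single (0 : Fin (n + 1)) v) := by
            ext i
            by_cases hi : i = ⟨0, hk⟩
            · subst hi
              simp [hM, columnMap]
            · have : i.castSucc ≠ 0 := fun h0 => hi (by ext; simpa using congrArg Fin.val h0)
              simp [hM, columnMap, hi, this]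
          simp [g, hk, this, -Submodule.mkQ_apply, hrange]
        · simp [g, hk]
      · intro k v
        by_cases hk : k + 1 < n
        · have : Pi.single (⟨k, by omega⟩ : Fin n) (act (0, h k - h (k + 1)) v)
              - Pi.single (⟨k + 1, hk⟩ : Fin n) (act (1, 0) v)
              = M (Pi.single (⟨k + 1, by omega⟩ : Fin (n + 1)) v) := by
            ext i
            by_cases hi : (i : ℕ) = k
            · simp [hM, columnMap, Pi.single_apply, Fin.ext_iff, hi]
            · by_cases hi' : (i : ℕ) = k + 1
              · simp [hM, columnMap, Pi.single_apply, Fin.ext_iff, hi']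
              · simp [hM, columnMap, Fin.ext_iff, hi, hi']
          have h2 := hrange (Pi.single (⟨k + 1, by omega⟩ : Fin (n + 1)) v)
          rw [← this, map_sub, sub_eq_zero] at h2
          simp only [g, hk, show k < n by omega, dif_pos, LinearMap.comp_apply,
            LinearMap.coe_single]
          exact h2.symm
        · by_cases hk' : k < n
          · have : Pi.single (⟨k, hk'⟩ : Fin n) (act (0, h k - h (k + 1)) v)
                = M (Pi.single (⟨k + 1, by omega⟩ : Fin (n + 1)) v) := by
              ext i
              by_cases hi : (i : ℕ) = k
              · simp [hM, columnMap, Pi.single_apply, Fin.ext_iff, hi]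
              · have : (i : ℕ) ≠ k + 1 := by have := i.2; omega
                simp [hM, columnMap, Fin.ext_iff, hi, this]
            simp only [g, hk, hk', dif_pos, LinearMap.comp_apply, LinearMap.coe_single, this,
              hrange]
            simp
          · simp [g, hk, hk']
      · intro k hk
        simp [g, not_lt.2 hk]
      · intro b c hb hc
        exact hQ b c hb hc
      · intro b c hbc
        by_cases hb : b < n
        · have : Pi.single (⟨b, hb⟩ : Fin n) (act (0, h b - 1 - c) v₀) = t (b, c) := by
            ext i
            simp [t, Pi.single_apply, Fin.ext_iff]
          simp only [g, hb, dif_pos, LinearMap.comp_apply, LinearMap.coe_single, this]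
          rw [Submodule.mkQ_apply, Submodule.Quotient.mk_eq_zero]
          refine Submodule.mem_sup_right (Submodule.subset_span ?_)
          exact Finset.mem_coe.2 (Finset.mem_image_of_mem t (Finset.mem_coe.1 hbc))
        · simp [g, hb]
    have : U.mkQ = 0 := by
      refine LinearMap.pi_ext' fun i => ?_
      have := hg i
      simpa [g] using this
    rw [← U.ker_mkQ, this, LinearMap.ker_zero]
  have h1 := LinearMap.finrank_range_add_finrank_ker M
  have h2 := Submodule.finrank_add_le_finrank_add_finrank (LinearMap.range M)
    (Submodule.span K (Q.image t : Set (Fin n → V)))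
  have h3 : Module.finrank K (Submodule.span K (Q.image t : Set (Fin n → V))) ≤ Q.card :=
    (finrank_span_finset_le_card _).trans Finset.card_image_le
  rw [htop, finrank_top] at h2
  simp only [Module.finrank_pi_fintype, Finset.sum_const, Finset.card_univ, Fintype.card_fin,
    smul_eq_mul] at h1 h2
  rw [add_mul] at h1
  omega

/-- Values of a compatible map on the lowest monomial of each column. -/
def columnValues (act : ℕ × ℕ → Module.End K V) (A : Set (ℕ × ℕ)) (h : ℕ → ℕ) (n : ℕ) :
    monomialHoms act A →ₗ[K] (Fin (n + 1) → V) :=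
  (LinearMap.pi fun i : Fin (n + 1) => LinearMap.proj ((i : ℕ), h i)) ∘ₗ
    (monomialHoms act A).subtype

/-- The monomials y^b z^(h b) with b ≤ n generate J: since h n = 0, y^n already lies in J and
accounts for all later columns. -/
theorem columnValues_injective (act : ℕ × ℕ → Module.End K V) (A : Set (ℕ × ℕ)) (h : ℕ → ℕ)
    (n : ℕ) (hn : h n = 0) (hA : ∀ b c, (b, c) ∈ A ↔ h b ≤ c) :
    Function.Injective (columnValues act A h n) := by
  rw [← LinearMap.ker_eq_bot, LinearMap.ker_eq_bot']
  rintro ⟨f, hf0, hf⟩ hv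
  have hval : ∀ b, b ≤ n → f (b, h b) = 0 := fun b hb =>
    congrFun hv ⟨b, by omega⟩
  ext ⟨b, c⟩
  change f (b, c) = 0
  by_cases hbc : (b, c) ∈ A
  · by_cases hb : b ≤ n
    · have := hf (b, h b) ((hA _ _).2 le_rfl) (0, c - h b)
      rw [hval b hb, map_zero] at this
      have e : ((0, c - h b) : ℕ × ℕ) + (b, h b) = (b, c) := by
        have := (hA _ _).1 hbc
        ext <;> simp; omega
      rwa [e] at this
    · have := hf (n, h n) ((hA _ _).2 le_rfl) (b - n, c)
      rw [hval n le_rfl, map_zero] at this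
      have e : ((b - n, c) : ℕ × ℕ) + (n, h n) = (b, c) := by
        ext <;> simp [hn]; omega
      rwa [e] at this
  · exact hf0 _ hbc

theorem columnValues_mem_ker (act : ℕ × ℕ → Module.End K V) (A : Set (ℕ × ℕ)) (h : ℕ → ℕ)
    (hanti : Antitone h) (n : ℕ) (hA : ∀ b c, (b, c) ∈ A ↔ h b ≤ c) (f : monomialHoms act A) :
    columnValues act A h n f ∈ LinearMap.ker (columnMap act h n) := by
  obtain ⟨f, hf0, hf⟩ := f
  rw [LinearMap.mem_ker]
  ext i
  change act (0, h i - h (i + 1)) (f ((i : ℕ) + 1, h (i + 1))) - act (1, 0) (f (i, h i)) = 0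
  rw [← hf _ ((hA _ _).2 le_rfl), ← hf _ ((hA _ _).2 le_rfl), sub_eq_zero]
  congr 1
  have := hanti (Nat.le_succ (i : ℕ))
  ext <;> simp at this ⊢ <;> omega

theorem finite_monomialHoms [FiniteDimensional K V] (act : ℕ × ℕ → Module.End K V)
    (A : Set (ℕ × ℕ)) (h : ℕ → ℕ) (n : ℕ) (hn : h n = 0) (hA : ∀ b c, (b, c) ∈ A ↔ h b ≤ c) :
    Module.Finite K (monomialHoms act A) :=
  Module.Finite.of_injective _ (columnValues_injective act A h n hn hA)

/-- The upper bound `dim Hom(J, V) ≤ dim V + #Q`, where `Q` is the set of monomials outside `J`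
which the annihilator of the cyclic generator of `V` multiplies into `J`. -/
theorem finrank_monomialHoms_le [FiniteDimensional K V]
    (act : ℕ × ℕ → Module.End K V) (hact : ∀ u w v, act (u + w) v = act u (act w v))
    (v₀ : V) (hspan : Submodule.span K (Set.range fun u => act u v₀) = ⊤)
    (A : Set (ℕ × ℕ)) (h : ℕ → ℕ) (hanti : Antitone h) (n : ℕ) (hn : h n = 0)
    (hA : ∀ b c, (b, c) ∈ A ↔ h b ≤ c) (Q : Finset (ℕ × ℕ))
    (hQ : ∀ s, s ∉ A → (∀ u, act u v₀ = 0 → s + u ∈ A) → s ∈ Q) :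
    Module.finrank K (monomialHoms act A) ≤ Module.finrank K V + Q.card := by
  refine le_trans ?_ (finrank_ker_columnMap_le act hact v₀ hspan h hanti n Q ?_)
  · refine LinearMap.finrank_le_finrank_of_injective
      (f := LinearMap.codRestrict _ (columnValues act A h n)
        (columnValues_mem_ker act A h hanti n hA)) ?_
    intro f g hfg
    exact columnValues_injective act A h n hn hA (congrArg Subtype.val hfg)
  · intro b c hbc hpq
    refine hQ (b, c) (fun hm => ?_) ?_
    · have := (hA b c).1 hm
      omega
    · rintro ⟨p, q⟩ hu
      exact (hA _ _).2 (hpq p q hu)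

/-- The compatible maps on `A` which vanish on `A'`. -/
def monomialHomsVanishing (act : ℕ × ℕ → Module.End K V) (A A' : Set (ℕ × ℕ)) :
    Submodule K (monomialHoms act A) where
  carrier := {f | ∀ u ∈ A', f.1 u = 0}
  add_mem' := by
    intro f g hf hg u hu
    simp [hf u hu, hg u hu]
  zero_mem' := by simp
  smul_mem' := by
    intro c f hf u hu
    simp [hf u hu]

/-- Each v in V gives the multiplication map u ↦ u·v on J. It vanishes on `A'` exactly when `A'`
annihilates v, so rank–nullity for V → Hom(J, V)/(maps vanishing on `A'`) yields the inequality. -/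
theorem finrank_monomialHomsVanishing_add_le [FiniteDimensional K V]
    (act : ℕ × ℕ → Module.End K V) (hact : ∀ u w v, act (u + w) v = act u (act w v))
    (A A' : Set (ℕ × ℕ)) (hAA' : A' ⊆ A) (hup : ∀ u ∈ A, ∀ w, w + u ∈ A)
    [Module.Finite K (monomialHoms act A)] (N : Submodule K V)
    (hN : ∀ v, (∀ u ∈ A', act u v = 0) → v ∈ N) :
    Module.finrank K (monomialHomsVanishing act A A') + Module.finrank K V
      ≤ Module.finrank K (monomialHoms act A) + Module.finrank K N := by
  classical
  let m : V →ₗ[K] monomialHoms act A :=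
    { toFun := fun v => ⟨fun u => if u ∈ A then act u v else 0, by
        refine ⟨fun u hu => by simp [hu], fun u hu w => ?_⟩
        simp [hu, hup u hu w, hact]⟩
      map_add' := by
        intro v w
        ext u
        by_cases hu : u ∈ A <;> simp [hu]
      map_smul' := by
        intro c v
        ext u
        by_cases hu : u ∈ A <;> simp [hu] }
  let q := (monomialHomsVanishing act A A').mkQ ∘ₗ m
  have h1 := LinearMap.finrank_range_add_finrank_ker q
  have h2 : LinearMap.ker q ≤ N := by
    intro v hv
    rw [LinearMap.mem_ker, LinearMap.comp_apply, Submodule.mkQ_apply,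
      Submodule.Quotient.mk_eq_zero] at hv
    refine hN v fun u hu => ?_
    have : (if u ∈ A then act u v else 0) = 0 := hv u hu
    rwa [if_pos (hAA' hu)] at this
  have h3 := Submodule.finrank_mono h2
  have h4 := Submodule.finrank_le (LinearMap.range q)
  have h5 := Submodule.finrank_quotient_add_finrank (monomialHomsVanishing act A A')
  omega

end PlanarHom

/-! ### The quotient S/J' modelled on functions on its monomial basis. -/

section Shift

variable {K : Type*} [Field K]

/-- Multiplication by the monomial with exponent `w` on the span of the monomials with exponents
in `B`, where monomials outside `B` are zero. -/
def shift (K : Type*) [Field K] (B : Finset (ℕ × ℕ)) (w : ℕ × ℕ) : Module.End K (B → K) where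
  toFun v s := if hs : w ≤ s.1 ∧ s.1 - w ∈ B then v ⟨s.1 - w, hs.2⟩ else 0
  map_add' v v' := by
    ext s
    by_cases hs : w ≤ s.1 ∧ s.1 - w ∈ B <;> simp [hs]
  map_smul' c v := by
    ext s
    by_cases hs : w ≤ s.1 ∧ s.1 - w ∈ B <;> simp [hs]

theorem shift_apply (B : Finset (ℕ × ℕ)) (w : ℕ × ℕ) (v : B → K) (s : B) :
    shift K B w v s = if hs : w ≤ s.1 ∧ s.1 - w ∈ B then v ⟨s.1 - w, hs.2⟩ else 0 := rfl

theorem shift_apply_add (B : Finset (ℕ × ℕ)) (w : ℕ × ℕ) (v : B → K) (s : B) (hs : s.1 + w ∈ B) :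
    shift K B w v ⟨s.1 + w, hs⟩ = v s := by
  rw [shift_apply, dif_pos]
  · congr 1
    ext <;> simp
  · refine ⟨le_add_self, ?_⟩
    simp

theorem shift_add (B : Finset (ℕ × ℕ)) (hB : ∀ s ∈ B, ∀ t, t ≤ s → t ∈ B) (u w : ℕ × ℕ)
    (v : B → K) : shift K B (u + w) v = shift K B u (shift K B w v) := by
  ext ⟨s, hs⟩
  have hsub : ∀ t : ℕ × ℕ, s - t ≤ s := fun t => tsub_le_self
  simp only [shift_apply, hB s hs _ (hsub _), and_true, hB _ (hB s hs _ (hsub u)) _ tsub_le_self]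
  by_cases hu : u ≤ s
  · by_cases hw : w ≤ s - u
    · have huw : u + w ≤ s := by
        obtain ⟨h1, h2⟩ := hu
        obtain ⟨h3, h4⟩ := hw
        refine ⟨?_, ?_⟩ <;> simp at * <;> omega
      simp only [hu, hw, huw, dif_pos]
      congr 2
      exact (tsub_tsub s u w).symm
    · have huw : ¬ u + w ≤ s := fun h => hw (by
        obtain ⟨h1, h2⟩ := h
        refine ⟨?_, ?_⟩ <;> simp at * <;> omega)
      simp [hu, hw, huw]
  · have huw : ¬ u + w ≤ s := fun h => hu (le_trans le_self_add h)
    simp [hu, huw]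

theorem shift_single (B : Finset (ℕ × ℕ)) (h0 : (0, 0) ∈ B) (w : ℕ × ℕ) :
    shift K B w (Pi.single ⟨(0, 0), h0⟩ 1) = fun s => if s.1 = w then 1 else 0 := by
  ext ⟨s, hs⟩
  rw [shift_apply]
  by_cases hw : s = w
  · subst hw
    have h0' : (0 : ℕ × ℕ) ∈ B := h0
    simp only [le_refl, tsub_self, true_and, dif_pos h0', if_true]
    exact Pi.single_eq_same _ _
  · by_cases h : w ≤ s ∧ s - w ∈ B
    · have : s - w ≠ (0, 0) := by
        intro h1
        apply hw
        obtain ⟨⟨h2, h3⟩, -⟩ := h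
        have h4 := congrArg Prod.fst h1
        have h5 := congrArg Prod.snd h1
        ext <;> simp at * <;> omega
      simp [h, hw, this]
    · simp [h, hw]

theorem span_shift_single (B : Finset (ℕ × ℕ)) (h0 : (0, 0) ∈ B) :
    Submodule.span K (Set.range fun w => shift K B w (Pi.single ⟨(0, 0), h0⟩ (1 : K))) = ⊤ := by
  classical
  rw [eq_top_iff]
  intro v _
  have : v = ∑ s : B, v s • shift K B s.1 (Pi.single ⟨(0, 0), h0⟩ (1 : K)) := by
    ext t
    simp [shift_single]
  rw [this]
  exact Submodule.sum_mem _ fun s _ => Submodule.smul_mem _ _ (Submodule.subset_span ⟨s.1, rfl⟩)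

theorem finrank_supported_le (B T : Finset (ℕ × ℕ)) (hT : T ⊆ B) (N : Submodule K (B → K))
    (hN : ∀ v ∈ N, ∀ s : B, s.1 ∉ T → v s = 0) : Module.finrank K N ≤ T.card := by
  let r : N →ₗ[K] (T → K) :=
    (LinearMap.pi fun s : T => LinearMap.proj (⟨s.1, hT s.2⟩ : B)) ∘ₗ N.subtype
  have hr : Function.Injective r := by
    rw [← LinearMap.ker_eq_bot, LinearMap.ker_eq_bot']
    rintro ⟨v, hv⟩ h
    ext s
    by_cases hs : s.1 ∈ T
    · exact congrFun h ⟨s.1, hs⟩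
    · exact hN v hv s hs
  simpa using LinearMap.finrank_le_finrank_of_injective hr

end Shift

/-! ### Planar monomial ideals of finite colength and their colon ideals. -/

/-- The complement of a planar monomial ideal whose monomials are `A` is the finite set
`B`. -/
structure IsStaircase (A : Set (ℕ × ℕ)) (B : Finset (ℕ × ℕ)) : Prop where
  mem_iff : ∀ s, s ∈ B ↔ s ∉ A
  add_mem : ∀ u ∈ A, ∀ w, w + u ∈ A

namespace IsStaircase

variable {A : Set (ℕ × ℕ)} {B : Finset (ℕ × ℕ)}

theorem lower (hAB : IsStaircase A B) : ∀ s ∈ B, ∀ t, t ≤ s → t ∈ B := by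
  intro s hs t hts
  rw [hAB.mem_iff] at hs ⊢
  intro ht
  apply hs
  have := hAB.add_mem t ht (s - t)
  rwa [tsub_add_cancel_of_le hts] at this

theorem exists_heights (hAB : IsStaircase A B) :
    ∃ h : ℕ → ℕ, Antitone h ∧ (∃ n, h n = 0) ∧ ∀ b c, (b, c) ∈ A ↔ h b ≤ c := by
  classical
  have hex : ∀ b, ∃ c, (b, c) ∈ A := by
    intro b
    by_contra! hc
    have hinj : Function.Injective fun c : ℕ => ((b, c) : ℕ × ℕ) := fun c d h => by simpa using h
    refine Set.infinite_range_of_injective hinj (B.finite_toSet.subset ?_)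
    rintro _ ⟨c, rfl⟩
    exact (hAB.mem_iff _).2 (hc c)
  have hiff : ∀ b c, (b, c) ∈ A ↔ Nat.find (hex b) ≤ c := by
    intro b c
    refine ⟨fun h => Nat.find_le h, fun h => ?_⟩
    have := hAB.add_mem _ (Nat.find_spec (hex b)) (0, c - Nat.find (hex b))
    have e : ((0, c - Nat.find (hex b)) : ℕ × ℕ) + (b, Nat.find (hex b)) = (b, c) := by
      ext <;> simp; omega
    rwa [e] at this
  refine ⟨fun b => Nat.find (hex b), ?_, ?_, hiff⟩
  · intro b b' hb
    rw [← hiff]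
    have := hAB.add_mem _ (Nat.find_spec (hex b)) (b' - b, 0)
    have e : ((b' - b, 0) : ℕ × ℕ) + (b, Nat.find (hex b)) = (b', Nat.find (hex b)) := by
      ext <;> simp; omega
    rwa [e] at this
  · by_contra! hn
    have hinj : Function.Injective fun b : ℕ => ((b, 0) : ℕ × ℕ) := fun c d h => by simpa using h
    refine Set.infinite_range_of_injective hinj (B.finite_toSet.subset ?_)
    rintro _ ⟨b, rfl⟩
    refine (hAB.mem_iff _).2 fun h => hn b ?_
    exact Nat.le_zero.1 ((hiff b 0).1 h)

open Classical in
/-- The monomials `s` outside the ideal `A` (with complement `B`) such that `s * A' ⊆ A`. -/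
noncomputable def colonFinset (A A' : Set (ℕ × ℕ)) (B : Finset (ℕ × ℕ)) : Finset (ℕ × ℕ) :=
  B.filter fun s => ∀ u ∈ A', s + u ∈ A

variable {K : Type*} [Field K] {A' : Set (ℕ × ℕ)} {B' : Finset (ℕ × ℕ)}

theorem finite_monomialHoms_shift (hAB : IsStaircase A B) (B' : Finset (ℕ × ℕ)) :
    Module.Finite K (monomialHoms (shift K B') A) := by
  obtain ⟨h, -, ⟨n, hn⟩, hA⟩ := hAB.exists_heights
  exact finite_monomialHoms _ A h n hn hA

/-- `dim Hom(J, S/J') ≤ dim S/J' + dim (J : J')/J` for monomial ideals in two variables. -/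
theorem finrank_monomialHoms_shift_le (hAB : IsStaircase A B) (hAB' : IsStaircase A' B')
    (h0 : (0, 0) ∈ B') :
    Module.finrank K (monomialHoms (shift K B') A) ≤ B'.card + (colonFinset A A' B).card := by
  obtain ⟨h, hanti, ⟨n, hn⟩, hA⟩ := hAB.exists_heights
  have := finrank_monomialHoms_le (shift K B') (shift_add B' hAB'.lower) _
    (span_shift_single B' h0) A h hanti n hn hA (colonFinset A A' B) ?_
  · simpa using this
  · intro s hs hu
    simp only [colonFinset, Finset.mem_filter]
    refine ⟨(hAB.mem_iff s).2 hs, fun u hu' => hu u ?_⟩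
    rw [shift_single]
    ext ⟨t, ht⟩
    have : t ≠ u := by
      rintro rfl
      exact (hAB'.mem_iff t).1 ht hu'
    simp [this]

/-- `dim Hom(J/J'', S/J') + dim S/J' ≤ dim Hom(J, S/J') + dim (J' : J'')/J'` for monomial ideals
`J'' ⊆ J` and `J'` in two variables. -/
theorem finrank_vanishing_add_le (hAB : IsStaircase A B) (hAB' : IsStaircase A' B')
    (A'' : Set (ℕ × ℕ)) (hA : A'' ⊆ A) :
    Module.finrank K (monomialHomsVanishing (shift K B') A A'') + B'.card
      ≤ Module.finrank K (monomialHoms (shift K B') A) + (colonFinset A' A'' B').card := by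
  classical
  have := hAB.finite_monomialHoms_shift (K := K) B'
  -- This is (J' : J'')/J', spanned by its monomials.
  let N : Submodule K (B' → K) :=
    { carrier := {v | ∀ s : B', s.1 ∉ colonFinset A' A'' B' → v s = 0}
      add_mem' := fun {v w} hv hw s hs => by simp [hv s hs, hw s hs]
      zero_mem' := fun s _ => rfl
      smul_mem' := fun c v hv s hs => by simp [hv s hs] }
  have h1 := finrank_monomialHomsVanishing_add_le (shift K B') (shift_add B' hAB'.lower) A A'' hA
    hAB.add_mem N ?_
  · have h2 := finrank_supported_le B' (colonFinset A' A'' B')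
      (Finset.filter_subset _ _) N fun v hv => hv
    simp only [Module.finrank_pi, Fintype.card_coe] at h1
    omega
  · intro v hv s hs
    simp only [colonFinset, Finset.mem_filter, not_and, not_forall] at hs
    obtain ⟨u, hu, hsu⟩ := hs s.2
    -- Multiplication by u moves the coefficient of v at s to s + u, still outside J', so it must
    -- vanish.
    have hmem : s.1 + u ∈ B' := (hAB'.mem_iff _).2 hsu
    have := congrFun (hv u hu) ⟨s.1 + u, hmem⟩
    rwa [shift_apply_add] at this

end IsStaircase

/-! ### Binomial sums. -/

theorem sum_range_succ_eq_choose (d : ℕ) : ∑ k ∈ Finset.range d, (k + 1) = (d + 1).choose 2 := by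
  induction d with
  | zero => rfl
  | succ d ih =>
    rw [Finset.sum_range_succ, ih, Nat.choose_succ_succ' (d + 1) 1]
    simp [add_comm]

theorem sum_range_choose_sub (m : ℕ) :
    ∑ j ∈ Finset.range m, (m - j + 1).choose 2 = (m + 2).choose 3 := by
  induction m with
  | zero => rfl
  | succ m ih =>
    rw [Finset.sum_range_succ']
    simp only [Nat.add_sub_add_right, ih, Nat.sub_zero]
    rw [Nat.choose_succ_succ' (m + 2) 2, add_comm]

/-- Passing from m to m + 1 adds a row and a column, each summing to C(m+2, 3), and a corner entry
C(1, 2) = 0; Pascal's rule closes the induction. -/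
theorem sum_choose_abs_sub (m : ℕ) :
    ∑ i ∈ Finset.range (m + 1), ∑ j ∈ Finset.range m,
      (if i ≤ j then (j - i + 1).choose 2 else (i - j).choose 2) = 2 * (m + 2).choose 4 := by
  induction m with
  | zero => rfl
  | succ m ih =>
    rw [Finset.sum_range_succ]
    have h0 : ∀ i, ∑ j ∈ Finset.range (m + 1),
        (if i ≤ j then (j - i + 1).choose 2 else (i - j).choose 2)
        = ∑ j ∈ Finset.range m, (if i ≤ j then (j - i + 1).choose 2 else (i - j).choose 2)
          + (if i ≤ m then (m - i + 1).choose 2 else (i - m).choose 2) :=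
      fun i => Finset.sum_range_succ _ m
    rw [Finset.sum_congr rfl fun i _ => h0 i, h0 (m + 1), Finset.sum_add_distrib, ih]
    have h1 : ∑ i ∈ Finset.range (m + 1),
        (if i ≤ m then (m - i + 1).choose 2 else (i - m).choose 2) = (m + 2).choose 3 := by
      rw [← sum_range_choose_sub, Finset.sum_range_succ]
      simp only [le_refl, if_true, Nat.sub_self]
      rw [show Nat.choose (0 + 1) 2 = 0 from rfl, add_zero]
      refine Finset.sum_congr rfl fun i hi => ?_
      rw [if_pos (Finset.mem_range.1 hi).le]
    have h2 : ∑ j ∈ Finset.range m,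
        (if m + 1 ≤ j then (j - (m + 1) + 1).choose 2 else (m + 1 - j).choose 2)
          = (m + 2).choose 3 := by
      rw [← sum_range_choose_sub]
      refine Finset.sum_congr rfl fun j hj => ?_
      have := Finset.mem_range.1 hj
      rw [if_neg (by omega), Nat.sub_add_comm (by omega)]
    have h3 : (if m + 1 ≤ m then (m - (m + 1) + 1).choose 2 else (m + 1 - m).choose 2) = 0 := by
      simp
    rw [h1, h2, h3, Nat.choose_succ_succ' (m + 2) 3]
    ring

/-! ### Slices of a Borel-fixed ideal. -/

/-- Exponents of a monomial ideal of finite colength in three variables, closed under replacing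
the second or third variable by the first one. -/
structure IsBorelStaircase (P : ℕ → ℕ → ℕ → Prop) (m₁ m₂ m₃ : ℕ) : Prop where
  up : ∀ {a b c a' b' c'}, P a b c → a ≤ a' → b ≤ b' → c ≤ c' → P a' b' c'
  move_y : ∀ {a b c}, P a (b + 1) c → P (a + 1) b c
  move_z : ∀ {a b c}, P a b (c + 1) → P (a + 1) b c
  pure_x : ∀ a, P a 0 0 ↔ m₁ ≤ a
  pure_y : P 0 m₂ 0
  pure_z : P 0 0 m₃

namespace IsBorelStaircase

variable {P : ℕ → ℕ → ℕ → Prop} {m₁ m₂ m₃ : ℕ}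

/-- The exponents with first coordinate `a`. -/
def slice (P : ℕ → ℕ → ℕ → Prop) (a : ℕ) : Set (ℕ × ℕ) := {s | P a s.1 s.2}

/-- The slice preceding `slice P a`. -/
def prevSlice (P : ℕ → ℕ → ℕ → Prop) (a : ℕ) : Set (ℕ × ℕ) :=
  {s | ∃ a', a' + 1 = a ∧ s ∈ slice P a'}

open Classical in
/-- The complement of `slice P a`. -/
noncomputable def coslice (P : ℕ → ℕ → ℕ → Prop) (m₂ m₃ a : ℕ) : Finset (ℕ × ℕ) :=
  (Finset.range m₂ ×ˢ Finset.range m₃).filter fun s => ¬ P a s.1 s.2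

theorem isStaircase (hP : IsBorelStaircase P m₁ m₂ m₃) (a : ℕ) :
    IsStaircase (slice P a) (coslice P m₂ m₃ a) where
  mem_iff s := by
    simp only [coslice, Finset.mem_filter, Finset.mem_product, Finset.mem_range, slice,
      Set.mem_ofPred_eq, and_iff_right_iff_imp]
    intro h
    constructor
    · by_contra! h2
      exact h (hP.up hP.pure_y (Nat.zero_le _) h2 (Nat.zero_le _))
    · by_contra! h2
      exact h (hP.up hP.pure_z (Nat.zero_le _) (Nat.zero_le _) h2)
  add_mem u hu w := hP.up hu le_rfl (by simp) (by simp)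

theorem move_all_z (hP : IsBorelStaircase P m₁ m₂ m₃) :
    ∀ {c a b}, P a b c → P (a + c) b 0
  | 0, _, _, h => h
  | c + 1, a, b, h => by
    have := hP.move_all_z (hP.move_z h)
    rwa [show a + (c + 1) = a + 1 + c by omega]

theorem move_all_y (hP : IsBorelStaircase P m₁ m₂ m₃) :
    ∀ {d a b c}, P a (b + d) c → P (a + d) b c
  | 0, _, _, _, h => h
  | d + 1, a, b, c, h => by
    have := hP.move_all_y (hP.move_y h)
    rwa [show a + (d + 1) = a + 1 + d by omega]

theorem zero_mem_coslice (hP : IsBorelStaircase P m₁ m₂ m₃) {j : ℕ} (hj : j < m₁) :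
    (0, 0) ∈ coslice P m₂ m₃ j := by
  rw [(hP.isStaircase j).mem_iff]
  intro h
  have := (hP.pure_x j).1 h
  omega

theorem coslice_eq_empty (hP : IsBorelStaircase P m₁ m₂ m₃) : coslice P m₂ m₃ m₁ = ∅ := by
  rw [Finset.eq_empty_iff_forall_notMem]
  intro s hs
  refine ((hP.isStaircase m₁).mem_iff s).1 hs ?_
  exact hP.up ((hP.pure_x m₁).2 le_rfl) le_rfl (Nat.zero_le _) (Nat.zero_le _)

/-- The colon ideal of two slices has only monomials of large degree. -/
theorem card_colonFinset_add_le (hP : IsBorelStaircase P m₁ m₂ m₃) {i j : ℕ} (hij : i ≤ j)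
    (hj : j < m₁) :
    (IsStaircase.colonFinset (slice P i) (slice P j) (coslice P m₂ m₃ i)).card
      + (j - i + 1).choose 2 ≤ (coslice P m₂ m₃ i).card := by
  classical
  -- Let y^(n+1) be the least power of y in slice j; the exponent is positive because j < m₁.
  have hex : ∃ n, P j n 0 := ⟨m₂, hP.up hP.pure_y (Nat.zero_le _) le_rfl le_rfl⟩
  obtain ⟨n, hn⟩ : ∃ n, Nat.find hex = n + 1 := by
    refine Nat.exists_eq_succ_of_ne_zero fun h => ?_
    have h0 := Nat.find_spec hex
    rw [h] at h0
    have := (hP.pure_x j).1 h0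
    omega
  have hn1 : P j (n + 1) 0 := hn ▸ Nat.find_spec hex
  have hn0 : ¬ P j n 0 := Nat.find_min hex (by omega)
  set T : Finset (ℕ × ℕ) := (Finset.range (j - i)).biUnion Finset.HasAntidiagonal.antidiagonal with hT
  have hTcard : T.card = (j - i + 1).choose 2 := by
    rw [hT, Finset.card_biUnion]
    · simp [sum_range_succ_eq_choose]
    · intro x _ y _ hxy
      rw [Function.onFun, Finset.disjoint_left]
      intro s hs hs'
      rw [Finset.HasAntidiagonal.mem_antidiagonal] at hs hs'
      exact hxy (hs.symm.trans hs')
  have hTmem : ∀ s ∈ T, s.1 + s.2 < j - i := by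
    intro s hs
    simp only [hT, Finset.mem_biUnion, Finset.mem_range, Finset.HasAntidiagonal.mem_antidiagonal] at hs
    obtain ⟨x, hx, rfl⟩ := hs
    exact hx
  have hdisj : Disjoint (IsStaircase.colonFinset (slice P i) (slice P j) (coslice P m₂ m₃ i)) T := by
    rw [Finset.disjoint_left]
    rintro ⟨p, q⟩ hs hsT
    have hlt := hTmem _ hsT
    simp only at hlt
    -- Trading z^q and p + 1 factors y for x leads to y^n in slice i + p + q + 1 ≤ j, against the
    -- minimality of n + 1.
    have h1 : P i (p + (n + 1)) (q + 0) := (Finset.mem_filter.1 hs).2 (n + 1, 0) hn1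
    have h2 := hP.move_all_z h1
    rw [show p + (n + 1) = n + (p + 1) by omega] at h2
    have h3 := hP.move_all_y h2
    exact hn0 (hP.up h3 (by omega) le_rfl le_rfl)
  rw [← hTcard, ← Finset.card_union_of_disjoint hdisj]
  refine Finset.card_le_card (Finset.union_subset (Finset.filter_subset _ _) ?_)
  rintro ⟨p, q⟩ hs
  have hlt := hTmem _ hs
  simp only at hlt
  rw [(hP.isStaircase i).mem_iff]
  -- If y^p z^q were in slice i, trading everything for x would put x^(i+p+q) in I with i + p + q <
  -- j < m₁.
  intro h
  have h2 := hP.move_all_z h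
  simp only at h2
  rw [show p = 0 + p by omega] at h2
  have := (hP.pure_x _).1 (hP.move_all_y h2)
  omega

/-- The bound for `Hom(Jᵢ/Jᵢ₋₁, S/Jⱼ)`, where `Jᵢ` are the slices of the ideal. -/
theorem finrank_vanishing_le (K : Type*) [Field K] (hP : IsBorelStaircase P m₁ m₂ m₃) {i j : ℕ}
    (hi : i ≤ m₁) (hj : j < m₁) :
    Module.finrank K (monomialHomsVanishing (shift K (coslice P m₂ m₃ j)) (slice P i)
        (prevSlice P i)) + (if i ≤ j then (j - i + 1).choose 2 else (i - j).choose 2)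
      ≤ (coslice P m₂ m₃ i).card + (coslice P m₂ m₃ j).card := by
  have h1 := (hP.isStaircase i).finrank_monomialHoms_shift_le (K := K) (hP.isStaircase j)
    (hP.zero_mem_coslice hj)
  classical
  split_ifs with hij
  · have := (hP.isStaircase i).finite_monomialHoms_shift (K := K) (coslice P m₂ m₃ j)
    have h2 := hP.card_colonFinset_add_le hij hj
    have h3 := Submodule.finrank_le (monomialHomsVanishing (shift K (coslice P m₂ m₃ j))
      (slice P i) (prevSlice P i))
    omega
  -- For i > j the saving comes from the colon J_j : J_{i-1}, where j ≤ i - 1; this is why C(i-j, 2)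
  -- replaces C(j-i+1, 2).
  · obtain ⟨i, rfl⟩ := Nat.exists_eq_succ_of_ne_zero (show i ≠ 0 by omega)
    have hprev : prevSlice P (i + 1) = slice P i := by
      ext s
      simp [prevSlice]
    have hsub : slice P i ⊆ slice P (i + 1) := fun s hs =>
      hP.up hs (Nat.le_succ i) le_rfl le_rfl
    have h2 := (hP.isStaircase (i + 1)).finrank_vanishing_add_le (K := K) (hP.isStaircase j)
      (slice P i) hsub
    have h3 := hP.card_colonFinset_add_le (i := j) (j := i) (by omega) (by omega)
    have h4 : (IsStaircase.colonFinset (slice P (i + 1)) (slice P j)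
        (coslice P m₂ m₃ (i + 1))).card ≤ (coslice P m₂ m₃ (i + 1)).card :=
      Finset.card_le_card (Finset.filter_subset _ _)
    rw [Nat.succ_eq_add_one] at *
    rw [hprev, Nat.sub_add_comm (by omega)]
    omega

end IsBorelStaircase

/-! ### From the tangent space to planar Hom spaces. -/

section TangentSpace

variable {K : Type*} [Field K] {I : Ideal (MvPolynomial (Fin 3) K)}

/-- The exponent vector `(a, b, c)`. -/
noncomputable def expVec (a b c : ℕ) : Fin 3 →₀ ℕ := Finsupp.equivFunOnFinite.symm ![a, b, c]

theorem expVec_add (a b c a' b' c' : ℕ) :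
    expVec a b c + expVec a' b' c' = expVec (a + a') (b + b') (c + c') := by
  ext i
  fin_cases i <;> simp [expVec]

theorem expVec_sub (a b c a' b' c' : ℕ) :
    expVec a b c - expVec a' b' c' = expVec (a - a') (b - b') (c - c') := by
  ext i
  fin_cases i <;> simp [expVec]

theorem expVec_le_iff (a b c a' b' c' : ℕ) :
    expVec a b c ≤ expVec a' b' c' ↔ a ≤ a' ∧ b ≤ b' ∧ c ≤ c' := by
  rw [Finsupp.le_def]
  simp [Fin.forall_fin_succ, expVec]

theorem eq_expVec (d : Fin 3 →₀ ℕ) : d = expVec (d 0) (d 1) (d 2) := by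
  ext i
  fin_cases i <;> simp [expVec]

theorem single_zero_eq (m : ℕ) : Finsupp.single (0 : Fin 3) m = expVec m 0 0 := by
  rw [eq_expVec (Finsupp.single _ _)]; simp

theorem single_one_eq (m : ℕ) : Finsupp.single (1 : Fin 3) m = expVec 0 m 0 := by
  rw [eq_expVec (Finsupp.single _ _)]; simp

theorem single_two_eq (m : ℕ) : Finsupp.single (2 : Fin 3) m = expVec 0 0 m := by
  rw [eq_expVec (Finsupp.single _ _)]; simp

theorem monomial_mem_of_le {d e : Fin 3 →₀ ℕ} (hd : monomial d (1 : K) ∈ I) (hde : d ≤ e) :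
    monomial e (1 : K) ∈ I := by
  have : monomial e (1 : K) = monomial (e - d) 1 * monomial d 1 := by
    rw [monomial_mul, tsub_add_cancel_of_le hde, one_mul]
  rw [this]
  exact I.mul_mem_left _ hd

theorem IsMonomialIdeal.monomial_mem (hI : IsMonomialIdeal I) {p : MvPolynomial (Fin 3) K}
    (hp : p ∈ I) {d : Fin 3 →₀ ℕ} (hd : coeff d p ≠ 0) : monomial d (1 : K) ∈ I := by
  obtain ⟨S, rfl⟩ := hI
  obtain ⟨s, hs, hsd⟩ := mem_ideal_span_monomial_image.1 hp d (mem_support_iff.2 hd)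
  exact monomial_mem_of_le (Ideal.subset_span ⟨s, hs, rfl⟩) hsd

theorem mem_of_forall_monomial_mem {p : MvPolynomial (Fin 3) K}
    (hp : ∀ d, coeff d p ≠ 0 → monomial d (1 : K) ∈ I) : p ∈ I := by
  rw [← support_sum_monomial_coeff p]
  refine Ideal.sum_mem _ fun d hd => ?_
  rw [← mul_one (coeff d p), ← C_mul_monomial]
  exact I.mul_mem_left _ (hp d (mem_support_iff.1 hd))

open Classical in
/-- The coefficient of a monomial outside a monomial ideal `I`, as a functional on the quotient;
it is zero for the monomials in `I`. -/
noncomputable def quotCoeff (hI : IsMonomialIdeal I) (d : Fin 3 →₀ ℕ) :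
    (MvPolynomial (Fin 3) K ⧸ I) →ₗ[K] K :=
  (Submodule.liftQ (I.restrictScalars K) (if monomial d (1 : K) ∈ I then 0 else lcoeff K d) (by
      intro p hp
      rw [LinearMap.mem_ker]
      split_ifs with hd
      · rfl
      · by_contra h
        exact hd (hI.monomial_mem hp h))) ∘ₗ
    (Submodule.Quotient.restrictScalarsEquiv K I).symm.toLinearMap

open Classical in
theorem quotCoeff_mk (hI : IsMonomialIdeal I) {d : Fin 3 →₀ ℕ} (hd : monomial d (1 : K) ∉ I)
    (p : MvPolynomial (Fin 3) K) : quotCoeff hI d (Ideal.Quotient.mk I p) = coeff d p := by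
  change (if monomial d (1 : K) ∈ I then 0 else lcoeff K d : _ →ₗ[K] K) p = _
  rw [if_neg hd]
  rfl

theorem eq_zero_of_quotCoeff (hI : IsMonomialIdeal I) (q : MvPolynomial (Fin 3) K ⧸ I)
    (hq : ∀ d, monomial d (1 : K) ∉ I → quotCoeff hI d q = 0) : q = 0 := by
  obtain ⟨p, rfl⟩ := Ideal.Quotient.mk_surjective q
  rw [Ideal.Quotient.eq_zero_iff_mem]
  refine mem_of_forall_monomial_mem fun d hd => ?_
  by_contra h
  exact hd (by rw [← quotCoeff_mk hI h, hq d h])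

theorem quotCoeff_monomial_smul (hI : IsMonomialIdeal I) {d : Fin 3 →₀ ℕ}
    (hd : monomial d (1 : K) ∉ I) (e : Fin 3 →₀ ℕ) (q : MvPolynomial (Fin 3) K ⧸ I) :
    quotCoeff hI d (monomial e (1 : K) • q) = if e ≤ d then quotCoeff hI (d - e) q else 0 := by
  obtain ⟨p, rfl⟩ := Ideal.Quotient.mk_surjective q
  have : monomial e (1 : K) • Ideal.Quotient.mk I p = Ideal.Quotient.mk I (monomial e 1 * p) := rfl
  rw [this, quotCoeff_mk hI hd, coeff_monomial_mul']
  split_ifs with he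
  · rw [quotCoeff_mk hI (fun h => hd (monomial_mem_of_le h tsub_le_self)), one_mul]
  · rfl

/-- The predicate that the monomial with exponents `(a, b, c)` lies in `I`. -/
abbrev expMem (I : Ideal (MvPolynomial (Fin 3) K)) (a b c : ℕ) : Prop :=
  monomial (expVec a b c) (1 : K) ∈ I

/-- Extends the exchange property from minimal generators to all monomials of I: if the generator
below d does not involve the variable j, lowering that exponent keeps the monomial a multiple of it.
-/
theorem IsBorelFixed.monomial_mem (hI : IsBorelFixed I) {d : Fin 3 →₀ ℕ}
    (hd : monomial d (1 : K) ∈ I) {i j : Fin 3} (hij : i < j) (hj : 0 < d j) :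
    monomial (d - Finsupp.single j 1 + Finsupp.single i 1) (1 : K) ∈ I := by
  obtain ⟨g, hgd, hg⟩ := exists_minimal_le_of_wellFoundedLT
    (fun b : Fin 3 →₀ ℕ => monomial b (1 : K) ∈ I) d hd
  by_cases hgj : 0 < g j
  · refine monomial_mem_of_le (hI.2 g hg i j hij hgj) ?_
    gcongr
  · refine monomial_mem_of_le hg.prop ?_
    refine le_trans (fun k => ?_) le_self_add
    have := hgd k
    by_cases hk : k = j
    · subst hk
      simp
      omega
    · simpa [Finsupp.single_apply, Ne.symm hk] using this

theorem IsBorelFixed.isBorelStaircase (hI : IsBorelFixed I) {m₁ m₂ m₃ : ℕ}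
    (hm₁ : IsPureExponent I 0 m₁) (hm₂ : IsPureExponent I 1 m₂) (hm₃ : IsPureExponent I 2 m₃) :
    IsBorelStaircase (expMem I) m₁ m₂ m₃ where
  up h ha hb hc := monomial_mem_of_le h ((expVec_le_iff _ _ _ _ _ _).2 ⟨ha, hb, hc⟩)
  move_y {a b c} h := by
    have := hI.monomial_mem h (i := 0) (j := 1) (by decide) (by simp [expVec])
    simpa [expMem, single_zero_eq, single_one_eq, expVec_sub, expVec_add] using this
  move_z {a b c} h := by
    have := hI.monomial_mem h (i := 0) (j := 2) (by decide) (by simp [expVec])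
    simpa [expMem, single_zero_eq, single_two_eq, expVec_sub, expVec_add] using this
  pure_x a := by
    rw [IsPureExponent, IsMinimalGenerator, single_zero_eq] at hm₁
    refine ⟨fun h => ?_, fun h => monomial_mem_of_le hm₁.prop (by simpa [expVec_le_iff] using h)⟩
    by_contra! ha
    have := hm₁.le_of_le h (by simpa [expVec_le_iff] using ha.le)
    simp [expVec_le_iff] at this
    omega
  pure_y := by simpa [expMem, single_one_eq] using Minimal.prop (P := fun b => monomial b (1 : K) ∈ I) hm₂
  pure_z := by simpa [expMem, single_two_eq] using Minimal.prop (P := fun b => monomial b (1 : K) ∈ I) hm₃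

open IsBorelStaircase

variable {m₁ m₂ m₃ : ℕ}

/-- The monomials outside I form a basis of R/I, and all of them have x-degree below m₁. -/
theorem finrank_quotient_eq (hI : IsMonomialIdeal I)
    (hP : IsBorelStaircase (expMem I) m₁ m₂ m₃) :
    Module.finrank K (MvPolynomial (Fin 3) K ⧸ I)
      = ∑ j ∈ Finset.range m₁, (coslice (expMem I) m₂ m₃ j).card := by
  classical
  let L : (MvPolynomial (Fin 3) K ⧸ I) →ₗ[K]
      ((Σ j : Fin m₁, coslice (expMem I) m₂ m₃ j) → K) :=
    LinearMap.pi fun s => quotCoeff hI (expVec s.1 s.2.1.1 s.2.1.2)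
  have hnot : ∀ s : (Σ j : Fin m₁, coslice (expMem I) m₂ m₃ j),
      monomial (expVec s.1 s.2.1.1 s.2.1.2) (1 : K) ∉ I := fun s =>
    ((hP.isStaircase s.1).mem_iff _).1 s.2.2
  have hinj : Function.Injective L := by
    rw [← LinearMap.ker_eq_bot, LinearMap.ker_eq_bot']
    intro q hq
    refine eq_zero_of_quotCoeff hI q fun d hd => ?_
    rw [eq_expVec d] at hd ⊢
    have h1 : d 0 < m₁ := by
      by_contra! h
      exact hd (hP.up ((hP.pure_x _).2 h) le_rfl (Nat.zero_le _) (Nat.zero_le _))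
    exact congrFun hq ⟨⟨d 0, h1⟩, ⟨(d 1, d 2), ((hP.isStaircase (d 0)).mem_iff _).2 hd⟩⟩
  have hsurj : Function.Surjective L := by
    intro v
    refine ⟨Ideal.Quotient.mk I (∑ s, monomial (expVec s.1 s.2.1.1 s.2.1.2) (v s)), ?_⟩
    ext t
    simp only [L, LinearMap.pi_apply]
    rw [quotCoeff_mk hI (hnot t), coeff_sum, Finset.sum_eq_single t]
    · simp
    · intro s _ hst
      rw [coeff_monomial, if_neg]
      intro h
      apply hst
      obtain ⟨⟨j, hj⟩, ⟨⟨b, c⟩, hbc⟩⟩ := s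
      obtain ⟨⟨j', hj'⟩, ⟨⟨b', c'⟩, hbc'⟩⟩ := t
      have h0 := DFunLike.congr_fun h 0
      have h1 := DFunLike.congr_fun h 1
      have h2 := DFunLike.congr_fun h 2
      simp [expVec] at h0 h1 h2
      subst h0 h1 h2
      rfl
    · simp
  rw [(LinearEquiv.ofBijective L ⟨hinj, hsurj⟩).finrank_eq, Module.finrank_pi, Fintype.card_sigma]
  simp [Finset.sum_range]

open Classical in
/-- The value of a tangent vector at a monomial, zero for the monomials outside `I`. -/
noncomputable def tangentValue (d : Fin 3 →₀ ℕ) :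
    TangentSpaceAt I →ₗ[K] (MvPolynomial (Fin 3) K ⧸ I) where
  toFun φ := if h : monomial d (1 : K) ∈ I then φ ⟨monomial d 1, h⟩ else 0
  map_add' φ ψ := by
    by_cases h : monomial d (1 : K) ∈ I <;> simp [h]
  map_smul' c φ := by
    by_cases h : monomial d (1 : K) ∈ I <;> simp [h]

theorem tangentValue_of_mem {d : Fin 3 →₀ ℕ} (hd : monomial d (1 : K) ∈ I)
    (φ : TangentSpaceAt I) : tangentValue d φ = φ ⟨monomial d 1, hd⟩ :=
  dif_pos hd

theorem tangentValue_of_notMem {d : Fin 3 →₀ ℕ} (hd : monomial d (1 : K) ∉ I)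
    (φ : TangentSpaceAt I) : tangentValue d φ = 0 :=
  dif_neg hd

theorem tangentValue_add {d : Fin 3 →₀ ℕ} (hd : monomial d (1 : K) ∈ I) (e : Fin 3 →₀ ℕ)
    (φ : TangentSpaceAt I) :
    tangentValue (e + d) φ = monomial e (1 : K) • tangentValue d φ := by
  have hed : monomial (e + d) (1 : K) ∈ I := monomial_mem_of_le hd le_add_self
  rw [tangentValue_of_mem hd, tangentValue_of_mem hed, ← map_smul]
  congr 1
  ext1
  simp [monomial_mul]

/-- The component of a tangent vector from the `i`-th slice of `I` to the `j`-th slice of the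
quotient. -/
noncomputable def tangentComponent (hI : IsMonomialIdeal I)
    (hP : IsBorelStaircase (expMem I) m₁ m₂ m₃) (i j : ℕ) :
    TangentSpaceAt I →ₗ[K]
      monomialHoms (shift K (coslice (expMem I) m₂ m₃ j)) (slice (expMem I) i) :=
  LinearMap.codRestrict _
    (LinearMap.pi fun u : ℕ × ℕ => LinearMap.pi fun s : coslice (expMem I) m₂ m₃ j =>
      quotCoeff hI (expVec j s.1.1 s.1.2) ∘ₗ tangentValue (expVec i u.1 u.2)) (by
    intro φ
    refine ⟨fun u hu => funext fun s => ?_, fun u hu w => funext fun s => ?_⟩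
    · change quotCoeff hI _ (tangentValue (expVec i u.1 u.2) φ) = 0
      rw [tangentValue_of_notMem hu, map_zero]
    · have hs := ((hP.isStaircase j).mem_iff _).1 s.2
      change quotCoeff hI _ (tangentValue (expVec i (w.1 + u.1) (w.2 + u.2)) φ) = _
      have e : expVec i (w.1 + u.1) (w.2 + u.2) = expVec 0 w.1 w.2 + expVec i u.1 u.2 := by
        rw [expVec_add, zero_add]
      rw [e, tangentValue_add hu, quotCoeff_monomial_smul hI hs, shift_apply, expVec_sub]
      by_cases hw : w ≤ s.1
      · have hmem := (hP.isStaircase j).lower s.1 s.2 (s.1 - w) tsub_le_self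
        rw [if_pos ((expVec_le_iff _ _ _ _ _ _).2 ⟨Nat.zero_le _, hw.1, hw.2⟩),
          dif_pos ⟨hw, hmem⟩]
        rfl
      · rw [if_neg (fun h => hw ((expVec_le_iff _ _ _ _ _ _).1 h).2), dif_neg (fun h => hw h.1)])

theorem tangentValue_eq_zero (hI : IsMonomialIdeal I)
    (hP : IsBorelStaircase (expMem I) m₁ m₂ m₃) {φ : TangentSpaceAt I} {i : ℕ}
    (h : ∀ j < m₁, tangentComponent hI hP i j φ = 0) (b c : ℕ) :
    tangentValue (expVec i b c) φ = 0 := by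
  refine eq_zero_of_quotCoeff hI _ fun d hd => ?_
  rw [eq_expVec d] at hd ⊢
  have h1 : d 0 < m₁ := by
    by_contra! h
    exact hd (hP.up ((hP.pure_x _).2 h) le_rfl (Nat.zero_le _) (Nat.zero_le _))
  exact congrFun (congrFun (congrArg Subtype.val (h _ h1)) (b, c))
    ⟨(d 1, d 2), ((hP.isStaircase (d 0)).mem_iff _).2 hd⟩

/-- The tangent vectors vanishing on the first `i` slices of `I`. -/
noncomputable def tangentFiltration (hI : IsMonomialIdeal I)
    (hP : IsBorelStaircase (expMem I) m₁ m₂ m₃) (i : ℕ) : Submodule K (TangentSpaceAt I) :=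
  ⨅ i' ∈ Finset.range i, ⨅ j ∈ Finset.range m₁, LinearMap.ker (tangentComponent hI hP i' j)

theorem mem_tangentFiltration (hI : IsMonomialIdeal I)
    (hP : IsBorelStaircase (expMem I) m₁ m₂ m₃) {i : ℕ} {φ : TangentSpaceAt I} :
    φ ∈ tangentFiltration hI hP i ↔ ∀ i' < i, ∀ j < m₁, tangentComponent hI hP i' j φ = 0 := by
  simp [tangentFiltration, Submodule.mem_iInf]

theorem tangentFiltration_eq_bot (hI : IsMonomialIdeal I)
    (hP : IsBorelStaircase (expMem I) m₁ m₂ m₃) : tangentFiltration hI hP (m₁ + 1) = ⊥ := by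
  rw [eq_bot_iff]
  intro φ hφ
  rw [mem_tangentFiltration] at hφ
  have hval : ∀ d, tangentValue d φ = 0 := by
    intro d
    rw [eq_expVec d]
    by_cases ha : d 0 ≤ m₁
    · exact tangentValue_eq_zero hI hP (hφ _ (by omega)) _ _
    -- Beyond slice m₁ every monomial is a multiple of x^(m₁), so the value there is determined by
    -- slice m₁. This is why m₁ + 1 source slices suffice.
    · have h0 : monomial (expVec m₁ 0 0) (1 : K) ∈ I := (hP.pure_x _).2 le_rfl
      have e : expVec (d 0) (d 1) (d 2) = expVec (d 0 - m₁) (d 1) (d 2) + expVec m₁ 0 0 := by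
        rw [expVec_add, Nat.sub_add_cancel (by omega), add_zero, add_zero]
      rw [e, tangentValue_add h0, tangentValue_eq_zero hI hP (hφ m₁ (by omega)) 0 0, smul_zero]
  have hle : I ≤ (LinearMap.ker φ).map I.subtype := by
    obtain ⟨S, hS⟩ := hI
    have hsub : ∀ d ∈ S, monomial d (1 : K) ∈ I := fun d hd => by
      rw [hS]
      exact Ideal.subset_span ⟨d, hd, rfl⟩
    conv_lhs => rw [hS]
    refine Ideal.span_le.2 ?_
    rintro _ ⟨d, hd, rfl⟩
    have hdI := hsub d hd
    refine ⟨⟨monomial d 1, hdI⟩, ?_, rfl⟩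
    exact (tangentValue_of_mem hdI φ).symm.trans (hval d)
  rw [Submodule.mem_bot]
  ext ⟨p, hp⟩
  obtain ⟨q, hq, hqp⟩ := hle hp
  have : q = ⟨p, hp⟩ := Subtype.ext hqp
  rw [← this]
  exact hq

/-- One step of the filtration. Finiteness of U is a conclusion, so that finite-dimensionality of
the whole tangent space comes out of the same induction. -/
theorem finrank_le_of_ker_le {T E : Type*} [AddCommGroup T] [Module K T] [AddCommGroup E]
    [Module K E] [Module.Finite K E] (U U' : Submodule K T) [Module.Finite K U'] (g : U →ₗ[K] E)
    (hg : ∀ x, g x = 0 → x.1 ∈ U') :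
    Module.Finite K U ∧ Module.finrank K U ≤ Module.finrank K E + Module.finrank K U' := by
  let r : LinearMap.ker g →ₗ[K] U' :=
    LinearMap.codRestrict U' (U.subtype ∘ₗ (LinearMap.ker g).subtype) fun x => hg x.1 x.2
  have hr : Function.Injective r := by
    intro x y hxy
    exact Subtype.ext (Subtype.ext (congrArg (fun z : U' => z.1) hxy))
  have : Module.Finite K (LinearMap.ker g) := Module.Finite.of_injective r hr
  have : Module.Finite K (U ⧸ LinearMap.ker g) :=
    Module.Finite.equiv g.quotKerEquivRange.symm
  have hU : Module.Finite K U := Module.Finite.of_submodule_quotient (LinearMap.ker g)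
  refine ⟨hU, ?_⟩
  rw [← LinearMap.finrank_range_add_finrank_ker g]
  exact add_le_add (Submodule.finrank_le _) (LinearMap.finrank_le_finrank_of_injective hr)

/-- The leading component of a tangent vector vanishing on the first `i` slices of `I`. -/
noncomputable def leadingComponent (hI : IsMonomialIdeal I)
    (hP : IsBorelStaircase (expMem I) m₁ m₂ m₃) (i : ℕ) :
    tangentFiltration hI hP i →ₗ[K] ((j : Fin m₁) →
      monomialHomsVanishing (shift K (coslice (expMem I) m₂ m₃ j)) (slice (expMem I) i)
        (prevSlice (expMem I) i)) :=
  LinearMap.pi fun j => LinearMap.codRestrict _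
    (tangentComponent hI hP i j ∘ₗ (tangentFiltration hI hP i).subtype) (by
      -- A monomial of the preceding slice times x has value x·0 = 0. For the first slice the
      -- condition is void, since its `prevSlice` is empty.
      rintro ⟨φ, hφ⟩ ⟨b, c⟩ ⟨i, rfl, hu⟩
      rw [mem_tangentFiltration] at hφ
      funext s
      change quotCoeff hI _ (tangentValue (expVec (i + 1) b c) φ) = 0
      have e : expVec (i + 1) b c = expVec 1 0 0 + expVec i b c := by
        rw [expVec_add, zero_add, zero_add, add_comm]
      rw [e, tangentValue_add hu, tangentValue_eq_zero hI hP (hφ i (Nat.lt_succ_self i)),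
        smul_zero, map_zero])

theorem finrank_tangentSpace_le (hI : IsMonomialIdeal I)
    (hP : IsBorelStaircase (expMem I) m₁ m₂ m₃) :
    Module.Finite K (TangentSpaceAt I) ∧ Module.finrank K (TangentSpaceAt I) ≤
      ∑ i ∈ Finset.range (m₁ + 1), ∑ j ∈ Finset.range m₁, Module.finrank K
        (monomialHomsVanishing (shift K (coslice (expMem I) m₂ m₃ j)) (slice (expMem I) i)
          (prevSlice (expMem I) i)) := by
  -- The induction climbs from the zero end of the filtration up to the full tangent space.
  have key : ∀ n, n ≤ m₁ + 1 → Module.Finite K (tangentFiltration hI hP (m₁ + 1 - n)) ∧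
      Module.finrank K (tangentFiltration hI hP (m₁ + 1 - n)) ≤
        ∑ i ∈ Finset.Ico (m₁ + 1 - n) (m₁ + 1), ∑ j ∈ Finset.range m₁, Module.finrank K
          (monomialHomsVanishing (shift K (coslice (expMem I) m₂ m₃ j)) (slice (expMem I) i)
            (prevSlice (expMem I) i)) := by
    intro n
    induction n with
    | zero =>
      intro _
      rw [Nat.sub_zero, tangentFiltration_eq_bot]
      exact ⟨inferInstance, by simp⟩
    | succ n ih =>
      intro hn
      obtain ⟨i, hi⟩ : ∃ i, m₁ + 1 - (n + 1) = i := ⟨_, rfl⟩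
      have hi' : m₁ + 1 - n = i + 1 := by omega
      rw [hi, Finset.sum_eq_sum_Ico_succ_bot (by omega)]
      rw [hi'] at ih
      obtain ⟨hfin, hle⟩ := ih (by omega)
      have hf : ∀ j : Fin m₁, Module.Finite K (monomialHoms
          (shift K (coslice (expMem I) m₂ m₃ j)) (slice (expMem I) i)) := fun j =>
        (hP.isStaircase i).finite_monomialHoms_shift _
      have hfree : ∀ j : Fin m₁, Module.Free K (monomialHomsVanishing
          (shift K (coslice (expMem I) m₂ m₃ j)) (slice (expMem I) i) (prevSlice (expMem I) i)) :=
        fun j => Module.Free.of_divisionRing K (monomialHomsVanishing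
          (shift K (coslice (expMem I) m₂ m₃ j)) (slice (expMem I) i) (prevSlice (expMem I) i))
      have hker : ∀ x : tangentFiltration hI hP i, leadingComponent hI hP i x = 0 →
          x.1 ∈ tangentFiltration hI hP (i + 1) := by
        rintro ⟨φ, hφ⟩ h
        rw [mem_tangentFiltration] at hφ ⊢
        intro i' hi' j hj
        rcases Nat.lt_succ_iff_lt_or_eq.1 hi' with h' | rfl
        · exact hφ i' h' j hj
        · exact congrArg Subtype.val (congrFun h ⟨j, hj⟩)
      obtain ⟨h1, h2⟩ := finrank_le_of_ker_le (E := (j : Fin m₁) → monomialHomsVanishing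
        (shift K (coslice (expMem I) m₂ m₃ j)) (slice (expMem I) i) (prevSlice (expMem I) i))
        (tangentFiltration hI hP i) (tangentFiltration hI hP (i + 1))
        (leadingComponent hI hP i) hker
      refine ⟨h1, h2.trans ?_⟩
      rw [Module.finrank_pi_fintype, Finset.sum_range]
      exact Nat.add_le_add_left hle _
  obtain ⟨h1, h2⟩ := key (m₁ + 1) le_rfl
  have htop : tangentFiltration hI hP (m₁ + 1 - (m₁ + 1)) = ⊤ := by
    simp [tangentFiltration]
  rw [htop] at h1 h2
  rw [finrank_top, Nat.sub_self, ← Finset.range_eq_Ico] at h2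
  exact ⟨Module.Finite.equiv Submodule.topEquiv, h2⟩

end TangentSpace

theorem theorem1p4 {K : Type*} [Field K] [CharZero K]
    (I : Ideal (MvPolynomial (Fin 3) K))
    (hI : IsBorelFixed I)
    (hI0 : IsArtinianRing (MvPolynomial (Fin 3) K ⧸ I))
    (m₁ m₂ m₃ : ℕ)
    (hm₁ : IsPureExponent I 0 m₁) (hm₂ : IsPureExponent I 1 m₂) (hm₃ : IsPureExponent I 2 m₃)
    (l k Δ : ℕ)
    (hl : Module.finrank K (MvPolynomial (Fin 3) K ⧸ I) = l)
    (hk : 1 ≤ k) (hΔ : Δ ≤ (k + 2).choose 2 - 1)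
    (hlk : l = (k + 2).choose 3 + Δ) :
    Module.Finite K (TangentSpaceAt I) ∧
      (Module.finrank K (TangentSpaceAt I) : ℤ) ≤
        (2 * (m₁ : ℤ) + 1) * (l : ℤ) - 2 * ((m₁ + 2).choose 4 : ℤ) := by
  have hP := hI.isBorelStaircase hm₁ hm₂ hm₃
  obtain ⟨hfin, hle⟩ := finrank_tangentSpace_le hI.1 hP
  refine ⟨hfin, ?_⟩
  rw [finrank_quotient_eq hI.1 hP] at hl
  -- Slice m₁ is all of S and adds nothing, so the source slices also sum to l. In the double sum,
  -- dim S/J_i is then counted m₁ times and dim S/J_j is counted m₁ + 1 times, whence (2m₁+1) l.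
  have hsum : ∑ i ∈ Finset.range (m₁ + 1), (IsBorelStaircase.coslice (expMem I) m₂ m₃ i).card
      = l := by
    rw [Finset.sum_range_succ, hP.coslice_eq_empty, hl, Finset.card_empty, add_zero]
  have hterm := Finset.sum_le_sum fun i (hi : i ∈ Finset.range (m₁ + 1)) =>
    Finset.sum_le_sum fun j (hj : j ∈ Finset.range m₁) =>
      hP.finrank_vanishing_le K (Nat.lt_succ_iff.1 (Finset.mem_range.1 hi)) (Finset.mem_range.1 hj)
  simp only [Finset.sum_add_distrib, sum_choose_abs_sub, Finset.sum_const, Finset.card_range,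
    smul_eq_mul, hl, ← Finset.mul_sum, hsum] at hterm
  have h := (Nat.add_le_add_right hle _).trans hterm
  zify at h
  linarith
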